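/- Consider a finite lexicographic MDP (LMDP): finite sets $\mathcal S$ (states), $\mathcal A$ (actions), $\mathcal E$ (events), a joint law $\mathbb P(s',e\mid s,a)$ of next state and event, vector rewards $r:\mathcal E\to\mathbb R^d$ and reward multipliers $\Gamma:\mathcal E\to\mathbb R^{d\times d}$ such that each $\Gamma(e)$ is either $0$ or a lower triangular matrix with positive diagonal entries. The return of a finite event sequence is given by $u(\varepsilon)=0$ and $u(e\cdot\tau)=r(e)+\Gamma(e)u(\tau)$. For a (possibly randomized and history-dependent) policy $\pi$, let $V^\pi(s)=\lim_{N\to\infty}\mathbb E_\pi[u(e_0,\dots,e_{N-1})\mid s_0=s]$, and let $Q^\pi(s,a)$ be defined in the same way, conditioning also on $a_0=a$, with $\pi$ followed thereafter. Vectors in $\mathbb R^d$ are compared lexicographically. Theorem (Fundamental Theorem of LMDPs). Assume $\Gamma_{i,i}(e)<1$ for all $e\in\mathcal E$ and $i\in\{1,\dots,d\}$. Then the limits defining $V^\pi$ and $Q^\pi$ exist for every policy. Let $\mathcal C$ be any class of policies that contains all stationary randomized policies $\pi:\mathcal S\to\Delta(\mathcal A)$ (for instance the class of exactly these, or the class of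 all history-dependent randomized policies). Then $Q^\star(s,a)=\operatorname{lexmax}_{\pi\in\mathcal C}Q^\pi(s,a)$ exists for all $s,a$, and a stationary policy $\pi:\mathcal S\to\Delta(\mathcal A)$ is uniformly optimal, that is, $V^{\pi}(s)\ge_{\mathrm{lex}}V^{\pi'}(s)$ for all $s\in\mathcal S$ and all $\pi'\in\mathcal C$, if and only if it is greedy with respect to $Q^\star$, that is, $\mathbb E_{a\sim\pi(s)}[Q^\star(s,a)]=\operatorname{lexmax}_{a}Q^\star(s,a)$ for all $s\in\mathcal S$. In that case, moreover, $Q^\pi=Q^\star$. -/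

import Mathlib

open Filter Topology

noncomputable section

/-- Lower triangular real `d × d` matrices with positive diagonal entries. -/
def lowerTriangularPos (d : ℕ) : Set (Matrix (Fin d) (Fin d) ℝ) :=
  {M | (∀ i j, i < j → M i j = 0) ∧ ∀ i, 0 < M i i}

/-- A lexicographic Markov decision process with states `S`, actions `A`, events `E` and
`d`-dimensional rewards. Given the current state and action, the next state and an event are
drawn jointly; the event carries the reward vector and the reward multiplier
(the matrix "discount"), which is `0` precisely for terminal events. -/
structure LMDP (S A E : Type*) (d : ℕ) where
  /-- joint law of the next state and the event -/
  trans : S → A → PMF (S × E)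
  /-- vector reward of an event -/
  reward : E → Fin d → ℝ
  /-- reward multiplier of an event -/
  mult : E → Matrix (Fin d) (Fin d) ℝ
  mult_mem : ∀ e, mult e ∈ lowerTriangularPos d ∪ {0}

/-- A (randomized, possibly history-dependent) policy: given the past steps
(state, action, event), oldest first, and the current state, a law of the next action. -/
abbrev Policy (S A E : Type*) := List (S × A × E) → S → PMF A

/-- The stationary randomized policy given by `π : S → Δ(A)`. -/
def stationary {S A : Type*} (E : Type*) (π : S → PMF A) : Policy S A E := fun _ => π

/-- The policy that `π` prescribes once the first step `(s, a, e)` has been made. -/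
def Policy.after {S A E : Type*} (π : Policy S A E) (s : S) (a : A) (e : E) : Policy S A E :=
  fun h => π ((s, a, e) :: h)

/-- Expectation of a vector-valued function under a discrete law. -/
def expect {α : Type*} {d : ℕ} (p : PMF α) (f : α → Fin d → ℝ) : Fin d → ℝ :=
  ∑' x, (p x).toReal • f x

namespace LMDP

variable {S A E : Type*} {d : ℕ}

/-- Utility (return) of a finite sequence of events:
`u(ε) = 0` and `u(e · τ) = r(e) + Γ(e) u(τ)`; that is,
`u(e₀, …, eₙ) = ∑ₜ Γ(e₀) ⋯ Γ(eₜ₋₁) r(eₜ)`. -/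
def utility (M : LMDP S A E d) : List E → Fin d → ℝ
  | [] => 0
  | e :: τ => M.reward e + (M.mult e).mulVec (M.utility τ)

/-- Law of the first `N` events when starting in `s` and following `π`. -/
def eventLaw (M : LMDP S A E d) : ℕ → Policy S A E → S → PMF (List E)
  | 0, _, _ => PMF.pure []
  | N + 1, π, s => (π [] s).bind fun a => (M.trans s a).bind fun x =>
      (M.eventLaw N (π.after s a x.2) x.1).map fun τ => x.2 :: τ

/-- Law of the first `N + 1` events when starting in `s`, taking action `a`, and following `π`
thereafter. -/
def eventLawAct (M : LMDP S A E d) (N : ℕ) (π : Policy S A E) (s : S) (a : A) : PMF (List E) :=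
  (M.trans s a).bind fun x =>
    (M.eventLaw N (π.after s a x.2) x.1).map fun τ => x.2 :: τ

/-- Value function `V^π(s)`: infinite-horizon expected return. -/
def V (M : LMDP S A E d) (π : Policy S A E) (s : S) : Fin d → ℝ :=
  limUnder atTop fun N => expect (M.eventLaw N π s) M.utility

/-- Q-function `Q^π(s, a)`: infinite-horizon expected return after starting in `s`, taking
action `a`, and following `π` thereafter. -/
def Q (M : LMDP S A E d) (π : Policy S A E) (s : S) (a : A) : Fin d → ℝ :=
  limUnder atTop fun N => expect (M.eventLawAct N π s a) M.utility

/-- `Qstar(s, a)` is the lexicographic maximum of `Q^π(s, a)` over the policies `π ∈ C`. -/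
def IsOptimalQ (M : LMDP S A E d) (C : Set (Policy S A E)) (Qstar : S → A → Fin d → ℝ) : Prop :=
  ∀ s a, IsGreatest ((fun π => toLex (M.Q π s a)) '' C) (toLex (Qstar s a))

/-- `π` is lexicographically optimal among the policies in `C`, from every start state. -/
def IsUniformlyOptimal (M : LMDP S A E d) (C : Set (Policy S A E)) (π : Policy S A E) : Prop :=
  ∀ s, ∀ π' ∈ C, toLex (M.V π' s) ≤ toLex (M.V π s)

end LMDP

/-- `π` is greedy for `q`: in every state `s`, the mean of `q(s, a)` for `a ∼ π(s)` is the
lexicographic maximum of `q(s, a)` over all actions `a`. -/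
def IsGreedy {S A : Type*} {d : ℕ} (q : S → A → Fin d → ℝ) (π : S → PMF A) : Prop :=
  ∀ s, IsGreatest (Set.range fun a => toLex (q s a)) (toLex (expect (π s) (q s)))

end

/-!
Conjugation by `diag(1, ε, ε², …)` shrinks the off-diagonal entries of the reward multipliers, so
for small `ε > 0` they are contractions for a common weighted sup norm, and the expected returns
converge geometrically, uniformly in the policy.

Lexicographic inequalities are not preserved by limits, so values cannot be compared by passing to
the limit in the finite-horizon inequalities. They are compared by a maximum principle instead: a
bounded `D` that lexicographically dominates the mean of `Γ D` over the next step is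
lexicographically nonnegative. This goes by induction on the dimension: where all but the last
coordinate of `D` vanish, they vanish at all successors reached with `Γ ≠ 0`, so there the last
coordinate satisfies a scalar discounted inequality.

The maximum principle makes policy improvement monotone, hence a maximal one among the finitely many
deterministic stationary policies yields a policy `ρ` that is greedy for its own `Q^ρ`. By the
maximum principle again, `V^ρ` dominates the value of every policy, and it is attained exactly by
the stationary policies that are greedy for `Q^ρ`.
-/

open Matrix

section Lexicographic

theorem toLex_nonneg_iff {ι R : Type*} [LinearOrder ι] [WellFoundedLT ι] [LinearOrder R] [Zero R]
    {x : ι → R} : 0 ≤ toLex x ↔ ∀ k, (∀ j < k, x j = 0) → 0 ≤ x k := by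
  refine ⟨fun h k hk => ?_, fun h => ?_⟩
  · exact Pi.apply_le_of_toLex (x := (0 : ι → R)) h fun j hj => (hk j hj).symm
  · by_contra hneg
    obtain ⟨k, hk, hxk⟩ := not_le.1 hneg
    exact (h k hk).not_gt hxk

theorem toLex_smul_nonneg {ι R : Type*} [LinearOrder ι] [WellFoundedLT ι] [Field R] [LinearOrder R]
    [IsStrictOrderedRing R] {c : R} (hc : 0 ≤ c) {x : ι → R} (hx : 0 ≤ toLex x) :
    0 ≤ toLex (c • x) := by
  rcases hc.eq_or_lt with rfl | hc
  · rw [zero_smul, toLex_zero]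
  · refine toLex_nonneg_iff.2 fun k hk => mul_nonneg hc.le (toLex_nonneg_iff.1 hx k fun j hj => ?_)
    exact (smul_eq_zero.1 (hk j hj)).resolve_left hc.ne'

theorem toLex_nonneg_iff_init {R : Type*} [LinearOrder R] [Zero R] {d : ℕ} {x : Fin (d + 1) → R} :
    0 ≤ toLex x ↔ 0 ≤ toLex (Fin.init x) ∧ (Fin.init x = 0 → 0 ≤ x (Fin.last d)) := by
  simp only [toLex_nonneg_iff, Fin.forall_fin_succ', Fin.castSucc_lt_castSucc_iff,
    Fin.castSucc_lt_last, forall_const, Fin.init, funext_iff, Pi.zero_apply]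
  simp [Fin.le_last]

theorem toLex_init_mono {R : Type*} [AddCommGroup R] [LinearOrder R] [IsOrderedAddMonoid R] {d : ℕ}
    {x y : Fin (d + 1) → R} (h : toLex x ≤ toLex y) :
    toLex (Fin.init x) ≤ toLex (Fin.init y) :=
  sub_nonneg.1 (toLex_nonneg_iff_init.1 (sub_nonneg.2 h)).1

end Lexicographic

section LowerTriangular

theorem init_mulVec {R : Type*} [NonUnitalNonAssocSemiring R] {d : ℕ}
    {G : Matrix (Fin (d + 1)) (Fin (d + 1)) R} (hG : G.IsLowerTriangular) (x : Fin (d + 1) → R) :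
    Fin.init (G *ᵥ x) = G.submatrix Fin.castSucc Fin.castSucc *ᵥ Fin.init x := by
  ext k
  have hk : G k.castSucc (Fin.last d) = 0 := hG (Fin.castSucc_lt_last k)
  simp [Fin.init, mulVec, dotProduct, Fin.sum_univ_castSucc, hk]

theorem mulVec_last_of_init_eq_zero {R : Type*} [NonUnitalNonAssocSemiring R] {d : ℕ}
    (G : Matrix (Fin (d + 1)) (Fin (d + 1)) R) {x : Fin (d + 1) → R} (hx : Fin.init x = 0) :
    (G *ᵥ x) (Fin.last d) = G (Fin.last d) (Fin.last d) * x (Fin.last d) := by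
  have hx' : ∀ k : Fin d, x k.castSucc = 0 := congrFun hx
  simp [mulVec, dotProduct, Fin.sum_univ_castSucc, hx']

variable {d : ℕ} {G : Matrix (Fin d) (Fin d) ℝ}

theorem isLowerTriangular_of_mem (hG : G ∈ lowerTriangularPos d ∪ {0}) : G.IsLowerTriangular := by
  rcases hG with hG | rfl
  · exact fun _ _ => hG.1 _ _
  · exact fun _ _ _ => rfl

theorem diag_nonneg_of_mem (hG : G ∈ lowerTriangularPos d ∪ {0}) (k : Fin d) : 0 ≤ G k k := by
  rcases hG with hG | rfl
  · exact (hG.2 k).le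
  · exact le_rfl

theorem eq_zero_of_mulVec_eq_zero_of_mem (hG : G ∈ lowerTriangularPos d) {x : Fin d → ℝ}
    (hx : G *ᵥ x = 0) : x = 0 := by
  refine Matrix.eq_zero_of_mulVec_eq_zero ?_ hx
  rw [det_of_isLowerTriangular G (isLowerTriangular_of_mem (.inl hG))]
  exact Finset.prod_ne_zero_iff.2 fun k _ => (hG.2 k).ne'

theorem submatrix_castSucc_mem_lowerTriangularPos {G : Matrix (Fin (d + 1)) (Fin (d + 1)) ℝ}
    (hG : G ∈ lowerTriangularPos (d + 1)) :
    G.submatrix Fin.castSucc Fin.castSucc ∈ lowerTriangularPos d :=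
  ⟨fun _ _ hij => hG.1 _ _ (Fin.castSucc_lt_castSucc_iff.2 hij), fun i => hG.2 i.castSucc⟩

theorem submatrix_castSucc_mem {G : Matrix (Fin (d + 1)) (Fin (d + 1)) ℝ}
    (hG : G ∈ lowerTriangularPos (d + 1) ∪ {0}) :
    G.submatrix Fin.castSucc Fin.castSucc ∈ lowerTriangularPos d ∪ {0} :=
  hG.imp submatrix_castSucc_mem_lowerTriangularPos fun h => by
    rw [Set.mem_singleton_iff.1 h, submatrix_zero]; rfl

theorem init_eq_zero_of_init_mulVec_eq_zero {G : Matrix (Fin (d + 1)) (Fin (d + 1)) ℝ}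
    (hG : G ∈ lowerTriangularPos (d + 1)) {x : Fin (d + 1) → ℝ} (hx : Fin.init (G *ᵥ x) = 0) :
    Fin.init x = 0 :=
  eq_zero_of_mulVec_eq_zero_of_mem (submatrix_castSucc_mem_lowerTriangularPos hG)
    (init_mulVec (isLowerTriangular_of_mem (.inl hG)) x ▸ hx)

theorem toLex_mulVec_nonneg (hG : G ∈ lowerTriangularPos d ∪ {0}) {x : Fin d → ℝ}
    (hx : 0 ≤ toLex x) : 0 ≤ toLex (G *ᵥ x) := by
  rcases hG with hG | rfl
  · induction d with
    | zero => exact (Subsingleton.elim _ _).le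
    | succ d ih =>
      obtain ⟨hinit, hlast⟩ := toLex_nonneg_iff_init.1 hx
      refine toLex_nonneg_iff_init.2 ⟨?_, fun h => ?_⟩
      · rw [init_mulVec (isLowerTriangular_of_mem (.inl hG))]
        exact ih hinit (submatrix_castSucc_mem_lowerTriangularPos hG)
      · have hx0 := init_eq_zero_of_init_mulVec_eq_zero hG h
        rw [mulVec_last_of_init_eq_zero G hx0]
        exact mul_nonneg (hG.2 _).le (hlast hx0)
  · rw [zero_mulVec, toLex_zero]

theorem exists_lt_one_forall_lt {ι : Type*} [Finite ι] {f : ι → ℝ} (hf : ∀ i, f i < 1) :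
    ∃ γ ∈ Set.Ioo (0 : ℝ) 1, ∀ i, f i < γ := by
  have hnear : ∀ᶠ γ in 𝓝[<] (1 : ℝ), γ ∈ Set.Ioo 0 1 := Ioo_mem_nhdsLT one_pos
  have hlt : ∀ᶠ γ in 𝓝[<] (1 : ℝ), ∀ i, f i < γ :=
    eventually_all.2 fun i => nhdsWithin_le_nhds (eventually_gt_nhds (hf i))
  exact (hnear.and hlt).exists

/-- The conjugate of a lower triangular matrix `G` by the diagonal matrix with entries `ε ^ k`,
written without inverses so that it makes sense, and is the diagonal part of `G`, at `ε = 0`. -/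
def powConj (G : Matrix (Fin d) (Fin d) ℝ) (ε : ℝ) : Matrix (Fin d) (Fin d) ℝ :=
  of fun k j => ε ^ (k.val - j.val) * G k j

theorem pow_mul_mulVec (hG : G.IsLowerTriangular) (ε : ℝ) (x : Fin d → ℝ) :
    (fun k : Fin d => ε ^ k.val) * (G *ᵥ x) =
      powConj G ε *ᵥ ((fun k : Fin d => ε ^ k.val) * x) := by
  ext k
  simp only [powConj, Pi.mul_apply, mulVec, dotProduct, Finset.mul_sum, of_apply]
  refine Finset.sum_congr rfl fun j _ => ?_
  rcases le_or_gt j k with hjk | hkj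
  · rw [← pow_sub_mul_pow ε (Fin.le_def.1 hjk)]
    ring
  · have hGkj : G k j = 0 := hG hkj
    rw [hGkj]
    ring

theorem powConj_zero (hG : G.IsLowerTriangular) : powConj G 0 = diagonal G.diag := by
  ext k j
  rw [powConj, of_apply]
  rcases lt_trichotomy j k with hjk | rfl | hkj
  · rw [zero_pow (Nat.sub_pos_of_lt hjk).ne', zero_mul, diagonal_apply_ne _ hjk.ne']
  · rw [Nat.sub_self, pow_zero, one_mul, diagonal_apply_eq, diag_apply]
  · have hGkj : G k j = 0 := hG hkj
    rw [hGkj, mul_zero, diagonal_apply_ne _ hkj.ne]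

theorem continuous_powConj (G : Matrix (Fin d) (Fin d) ℝ) : Continuous (powConj G) :=
  continuous_matrix fun _ _ => (continuous_pow _).mul continuous_const

open scoped Matrix.Norms.Operator in
theorem exists_weight_norm_mulVec_le {ι : Type*} [Finite ι] {G : ι → Matrix (Fin d) (Fin d) ℝ}
    (hG : ∀ i, (G i).IsLowerTriangular) (hdiag : ∀ i k, |G i k k| < 1) :
    ∃ w : Fin d → ℝ, (∀ k, 0 < w k) ∧ ∃ β ∈ Set.Ioo (0 : ℝ) 1,
      ∀ i x, ‖w * (G i *ᵥ x)‖ ≤ β * ‖w * x‖ := by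
  obtain ⟨β, hβ, hGβ⟩ := exists_lt_one_forall_lt fun z : ι × Fin d => hdiag z.1 z.2
  have hnorm_zero (i) : ‖powConj (G i) 0‖ < β := by
    rw [powConj_zero (hG i), linfty_opNorm_diagonal]
    exact (pi_norm_lt_iff hβ.1).2 fun k => hGβ (i, k)
  have hnorm : ∀ᶠ ε in 𝓝[>] (0 : ℝ), ∀ i, ‖powConj (G i) ε‖ < β :=
    eventually_all.2 fun i => nhdsWithin_le_nhds <|
      (continuous_powConj (G i)).norm.continuousAt.eventually (gt_mem_nhds (hnorm_zero i))
  obtain ⟨ε, hε, hε0⟩ := (hnorm.and eventually_mem_nhdsWithin).exists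
  refine ⟨fun k => ε ^ k.val, fun k => pow_pos hε0 _, β, hβ, fun i x => ?_⟩
  rw [pow_mul_mulVec (hG i)]
  exact (linfty_opNorm_mulVec _ _).trans (mul_le_mul_of_nonneg_right (hε i).le (norm_nonneg _))

end LowerTriangular

section Expect

variable {α β : Type*} {d : ℕ} {p : PMF α}

theorem sum_toReal_eq_one {t : Finset α} (ht : p.support ⊆ t) : ∑ a ∈ t, (p a).toReal = 1 := by
  have hsum : ∑ a ∈ t, p a = 1 := (tsum_eq_sum fun a ha =>
    (p.apply_eq_zero_iff a).2 fun h => ha (ht h)).symm.trans p.tsum_coe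
  rw [← ENNReal.toReal_sum fun a _ => p.apply_ne_top a, hsum, ENNReal.toReal_one]

theorem expect_eq_sum {t : Finset α} (ht : p.support ⊆ t) (f : α → Fin d → ℝ) :
    expect p f = ∑ a ∈ t, (p a).toReal • f a :=
  tsum_eq_sum fun a ha => by
    rw [(p.apply_eq_zero_iff a).2 fun h => ha (ht h), ENNReal.toReal_zero, zero_smul]

theorem expect_pure (a : α) (f : α → Fin d → ℝ) : expect (PMF.pure a) f = f a := by
  rw [expect_eq_sum (t := {a}) (by simp), Finset.sum_singleton, PMF.pure_apply_self,
    ENNReal.toReal_one, one_smul]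

theorem finite_support_bind (hp : p.support.Finite) {q : α → PMF β}
    (hq : ∀ a, (q a).support.Finite) : (p.bind q).support.Finite := by
  rw [PMF.support_bind]
  exact hp.biUnion fun a _ => hq a

theorem finite_support_map (hp : p.support.Finite) (g : α → β) : (p.map g).support.Finite := by
  rw [PMF.support_map]
  exact hp.image g

theorem expect_bind (hp : p.support.Finite) {q : α → PMF β} (hq : ∀ a, (q a).support.Finite)
    (f : β → Fin d → ℝ) : expect (p.bind q) f = expect p fun a => expect (q a) f := by
  have hbind := finite_support_bind hp hq
  have hsub (a) (ha : a ∈ p.support) : (q a).support ⊆ hbind.toFinset := fun b hb => by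
    simpa using ⟨a, ha, hb⟩
  have happly (b) : (p.bind q b).toReal = ∑ a ∈ hp.toFinset, (p a).toReal * (q a b).toReal := by
    rw [PMF.bind_apply, tsum_eq_sum (s := hp.toFinset), ENNReal.toReal_sum]
    · simp only [ENNReal.toReal_mul]
    · exact fun a _ => ENNReal.mul_ne_top (p.apply_ne_top a) ((q a).apply_ne_top b)
    · exact fun a ha => by rw [(p.apply_eq_zero_iff a).2 (by simpa using ha), zero_mul]
  rw [expect_eq_sum hbind.coe_toFinset.ge, expect_eq_sum hp.coe_toFinset.ge]
  simp only [happly, Finset.sum_smul, mul_smul]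
  rw [Finset.sum_comm]
  refine Finset.sum_congr rfl fun a ha => ?_
  rw [← Finset.smul_sum, expect_eq_sum (hsub a (by simpa using ha))]

theorem expect_map (hp : p.support.Finite) (g : α → β) (f : β → Fin d → ℝ) :
    expect (p.map g) f = expect p fun a => f (g a) := by
  have hpure (b : β) : (PMF.pure b).support.Finite := by simp
  exact (expect_bind hp (q := PMF.pure ∘ g) (fun a => hpure (g a)) f).trans
    (congrArg _ (funext fun a => expect_pure (g a) f))

theorem expect_const (p : PMF α) (c : Fin d → ℝ) : expect p (fun _ => c) = c := by
  have hsum : ∑' a, (p a).toReal = 1 := by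
    rw [← ENNReal.tsum_toReal_eq p.apply_ne_top, p.tsum_coe, ENNReal.toReal_one]
  have hsummable : Summable fun a => (p a).toReal :=
    ENNReal.summable_toReal p.tsum_coe_ne_top
  rw [expect, hsummable.tsum_smul_const, hsum, one_smul]

theorem expect_add (hp : p.support.Finite) (f g : α → Fin d → ℝ) :
    expect p (fun a => f a + g a) = expect p f + expect p g := by
  simp only [expect_eq_sum hp.coe_toFinset.ge, smul_add, Finset.sum_add_distrib]

theorem expect_sub (hp : p.support.Finite) (f g : α → Fin d → ℝ) :
    expect p (fun a => f a - g a) = expect p f - expect p g := by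
  simp only [expect_eq_sum hp.coe_toFinset.ge, smul_sub, Finset.sum_sub_distrib]

theorem expect_linearMap (hp : p.support.Finite) {d' : ℕ} (L : (Fin d → ℝ) →ₗ[ℝ] Fin d' → ℝ)
    (f : α → Fin d → ℝ) : expect p (fun a => L (f a)) = L (expect p f) := by
  simp only [expect_eq_sum hp.coe_toFinset.ge, map_sum, map_smul]

theorem init_expect (hp : p.support.Finite) (f : α → Fin (d + 1) → ℝ) :
    Fin.init (expect p f) = expect p fun a => Fin.init (f a) :=
  (expect_linearMap hp (LinearMap.funLeft ℝ ℝ Fin.castSucc) f).symm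

theorem expect_mem_of_convex (hp : p.support.Finite) {s : Set (Fin d → ℝ)} (hs : Convex ℝ s)
    {f : α → Fin d → ℝ} (hf : ∀ a ∈ p.support, f a ∈ s) : expect p f ∈ s := by
  rw [expect_eq_sum hp.coe_toFinset.ge]
  exact hs.sum_mem (fun _ _ => ENNReal.toReal_nonneg) (sum_toReal_eq_one hp.coe_toFinset.ge)
    fun a ha => hf a (hp.mem_toFinset.1 ha)

theorem norm_mul_expect_le (hp : p.support.Finite) (w : Fin d → ℝ) {f : α → Fin d → ℝ} {K : ℝ}
    (hf : ∀ a, ‖w * f a‖ ≤ K) : ‖w * expect p f‖ ≤ K := by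
  have hmem := expect_mem_of_convex hp (convex_closedBall 0 K) fun a _ =>
    mem_closedBall_zero_iff.2 (hf a)
  have hL : expect p (fun a => w * f a) = w * expect p f :=
    expect_linearMap hp (LinearMap.mulLeft ℝ w) f
  rwa [hL, mem_closedBall_zero_iff] at hmem

theorem tendsto_expect (hp : p.support.Finite) {ι : Type*} {l : Filter ι}
    {F : ι → α → Fin d → ℝ} {f : α → Fin d → ℝ}
    (hF : ∀ a, Tendsto (fun i => F i a) l (𝓝 (f a))) :
    Tendsto (fun i => expect p (F i)) l (𝓝 (expect p f)) := by
  simp only [expect_eq_sum hp.coe_toFinset.ge]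
  exact tendsto_finsetSum _ fun a _ => (hF a).const_smul _

theorem toLex_expect_nonneg (hp : p.support.Finite) {f : α → Fin d → ℝ}
    (hf : ∀ a, 0 ≤ toLex (f a)) : 0 ≤ toLex (expect p f) := by
  rw [expect_eq_sum hp.coe_toFinset.ge]
  exact Finset.sum_nonneg (N := Lex (Fin d → ℝ)) fun a _ =>
    toLex_smul_nonneg ENNReal.toReal_nonneg (hf a)

theorem toLex_expect_mono (hp : p.support.Finite) {f g : α → Fin d → ℝ}
    (hfg : ∀ a, toLex (f a) ≤ toLex (g a)) : toLex (expect p f) ≤ toLex (expect p g) := by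
  rw [← sub_nonneg, ← toLex_sub, ← expect_sub hp]
  exact toLex_expect_nonneg hp fun a => sub_nonneg.2 (hfg a)

theorem toLex_expect_le (hp : p.support.Finite) {f : α → Fin d → ℝ} {c : Fin d → ℝ}
    (hf : ∀ a, toLex (f a) ≤ toLex c) : toLex (expect p f) ≤ toLex c := by
  simpa only [expect_const] using toLex_expect_mono hp (g := fun _ => c) hf

theorem eq_zero_of_expect_eq_zero (hp : p.support.Finite) {f : α → Fin d → ℝ}
    (hf : ∀ a, 0 ≤ toLex (f a)) (h0 : expect p f = 0) {a : α} (ha : a ∈ p.support) : f a = 0 := by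
  rw [expect_eq_sum hp.coe_toFinset.ge] at h0
  have hterm := (Finset.sum_eq_zero_iff_of_nonneg (N := Lex (Fin d → ℝ)) fun a _ =>
    toLex_smul_nonneg ENNReal.toReal_nonneg (hf a)).1 h0 a (hp.mem_toFinset.2 ha)
  exact (smul_eq_zero.1 hterm).resolve_left (ENNReal.toReal_ne_zero.2 ⟨ha, p.apply_ne_top a⟩)

end Expect

section MaximumPrinciple

theorem nonneg_of_forall_mul_le {X : Type*} {s : Set X} {f : X → ℝ} {γ : ℝ} (hγ : γ < 1)
    (hf : BddBelow (f '' s))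
    (hstep : ∀ c ≤ 0, (∀ x ∈ s, c ≤ f x) → ∀ x ∈ s, γ * c ≤ f x) : ∀ x ∈ s, 0 ≤ f x := by
  intro x hx
  obtain ⟨c, hglb⟩ := Real.exists_isGLB ⟨f x, Set.mem_image_of_mem f hx⟩ hf
  by_contra! hfx
  have hcf : ∀ x ∈ s, c ≤ f x := fun x hx => hglb.1 (Set.mem_image_of_mem f hx)
  have hc : c < 0 := (hcf x hx).trans_lt hfx
  have hγc : γ * c ≤ c := hglb.2 (Set.forall_mem_image.2 (hstep c hc.le hcf))
  exact hγc.not_gt (lt_mul_of_lt_one_left hc hγ)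

variable {ι : Type*} {d : ℕ}

theorem le_last_expect_mulVec {p : PMF ι} (hp : p.support.Finite)
    {G : ι → Matrix (Fin (d + 1)) (Fin (d + 1)) ℝ}
    (hG : ∀ i, G i ∈ lowerTriangularPos (d + 1) ∪ {0}) {γ : ℝ} (hγ : 0 ≤ γ)
    (hGγ : ∀ i, G i (Fin.last d) (Fin.last d) ≤ γ) {F : ι → Fin (d + 1) → ℝ} {c : ℝ} (hc : c ≤ 0)
    (hF : ∀ i, Fin.init (F i) = 0 → c ≤ F i (Fin.last d))
    (hinit : ∀ i ∈ p.support, Fin.init (G i *ᵥ F i) = 0) :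
    γ * c ≤ expect p (fun i => G i *ᵥ F i) (Fin.last d) := by
  have hconvex : Convex ℝ {v : Fin (d + 1) → ℝ | γ * c ≤ v (Fin.last d)} :=
    convex_halfSpace_ge (LinearMap.proj (Fin.last d)).isLinear _
  refine expect_mem_of_convex hp hconvex fun i hi => ?_
  change γ * c ≤ (G i *ᵥ F i) (Fin.last d)
  rcases hG i with hGi | hGi
  · have hFi := init_eq_zero_of_init_mulVec_eq_zero hGi (hinit i hi)
    rw [mulVec_last_of_init_eq_zero _ hFi]
    calc γ * c ≤ G i (Fin.last d) (Fin.last d) * c := mul_le_mul_of_nonpos_right (hGγ i) hc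
      _ ≤ G i (Fin.last d) (Fin.last d) * F i (Fin.last d) :=
        mul_le_mul_of_nonneg_left (hF i hFi) (hGi.2 _).le
  · rw [Set.mem_singleton_iff.1 hGi, zero_mulVec]
    exact mul_nonpos_of_nonneg_of_nonpos hγ hc

theorem mul_le_last_of_expect_mulVec_le {p : PMF ι} (hp : p.support.Finite)
    {G : ι → Matrix (Fin (d + 1)) (Fin (d + 1)) ℝ}
    (hG : ∀ i, G i ∈ lowerTriangularPos (d + 1) ∪ {0}) {γ : ℝ} (hγ : 0 ≤ γ)
    (hGγ : ∀ i, G i (Fin.last d) (Fin.last d) ≤ γ) {F : ι → Fin (d + 1) → ℝ} {c : ℝ} (hc : c ≤ 0)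
    (hF : ∀ i, Fin.init (F i) = 0 → c ≤ F i (Fin.last d))
    (hF0 : ∀ i, 0 ≤ toLex (Fin.init (F i))) {y : Fin (d + 1) → ℝ} (hy : Fin.init y = 0)
    (h : toLex (expect p fun i => G i *ᵥ F i) ≤ toLex y) : γ * c ≤ y (Fin.last d) := by
  have hnonneg (i) : 0 ≤ toLex (Fin.init (G i *ᵥ F i)) := by
    rw [init_mulVec (isLowerTriangular_of_mem (hG i))]
    exact toLex_mulVec_nonneg (submatrix_castSucc_mem (hG i)) (hF0 i)
  have hmean : (expect p fun i => Fin.init (G i *ᵥ F i)) = 0 := by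
    refine toLex_inj.1 (le_antisymm ?_ (toLex_expect_nonneg hp hnonneg))
    simpa only [init_expect hp, hy] using toLex_init_mono h
  have hinit : Fin.init (y - expect p fun i => G i *ᵥ F i) = 0 := by
    have hsub : Fin.init (y - expect p fun i => G i *ᵥ F i) =
      Fin.init y - Fin.init (expect p fun i => G i *ᵥ F i) := rfl
    rw [hsub, hy, init_expect hp, hmean, sub_zero]
  calc γ * c ≤ expect p (fun i => G i *ᵥ F i) (Fin.last d) :=
        le_last_expect_mulVec hp hG hγ hGγ hc hF
          fun i hi => eq_zero_of_expect_eq_zero hp hnonneg hmean hi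
    _ ≤ y (Fin.last d) := sub_nonneg.1 ((toLex_nonneg_iff_init.1 (sub_nonneg.2 h)).2 hinit)

theorem toLex_nonneg_of_expect_mulVec_le {X : Type*} [Finite ι] {p : X → PMF ι}
    {G : ι → Matrix (Fin d) (Fin d) ℝ} (hG : ∀ i, G i ∈ lowerTriangularPos d ∪ {0})
    (hdiag : ∀ i k, G i k k < 1) {next : X → ι → X} {D : X → Fin d → ℝ} {B : ℝ}
    (hB : ∀ x k, B ≤ D x k)
    (h : ∀ x, toLex (expect (p x) fun i => G i *ᵥ D (next x i)) ≤ toLex (D x)) (x : X) :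
    0 ≤ toLex (D x) := by
  induction d generalizing x with
  | zero => exact (Subsingleton.elim _ _).le
  | succ d ih =>
    have hfin (x) : (p x).support.Finite := Set.toFinite _
    have hinit : ∀ x, 0 ≤ toLex (Fin.init (D x)) := by
      refine ih (fun i => submatrix_castSucc_mem (hG i)) (fun i k => hdiag i k.castSucc)
        (fun x k => hB x k.castSucc) fun x => ?_
      have hx := toLex_init_mono (h x)
      rw [init_expect (hfin x)] at hx
      simpa only [init_mulVec (isLowerTriangular_of_mem (hG _))] using hx
    obtain ⟨γ, ⟨hγ0, hγ1⟩, hGγ⟩ := exists_lt_one_forall_lt fun i => hdiag i (Fin.last d)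
    have hlast : ∀ x ∈ {x | Fin.init (D x) = 0}, 0 ≤ D x (Fin.last d) := by
      refine nonneg_of_forall_mul_le hγ1 ⟨B, Set.forall_mem_image.2 fun x _ => hB x _⟩
        fun c hc hcD x hx => ?_
      exact mul_le_last_of_expect_mulVec_le (hfin x) hG hγ0.le (fun i => (hGγ i).le) hc
        (fun i hi => hcD _ hi) (fun i => hinit _) hx (h x)
    exact toLex_nonneg_iff_init.2 ⟨hinit x, hlast x⟩

end MaximumPrinciple

namespace LMDP

variable {S A E : Type*} {d : ℕ}

/-- The one-step backup: the expected return of action `a` in state `s` when reaching the next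
state `s'` through the event `e` is worth `W (s', e)`. -/
noncomputable def backup (M : LMDP S A E d) (W : S × E → Fin d → ℝ) (s : S) (a : A) : Fin d → ℝ :=
  expect (M.trans s a) fun x => M.reward x.2 + M.mult x.2 *ᵥ W x

/-- The `N`-step value function, whose limit is `V^π`. -/
noncomputable def horizonValue (M : LMDP S A E d) (N : ℕ) (π : Policy S A E) (s : S) :
    Fin d → ℝ :=
  expect (M.eventLaw N π s) M.utility

/-- Joint law of the action, next state and event when the action in state `s` is drawn
from `q`. -/
noncomputable def stepLaw (M : LMDP S A E d) (q : PMF A) (s : S) : PMF (A × S × E) :=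
  q.bind fun a => (M.trans s a).map (Prod.mk a)

theorem horizonValue_zero (M : LMDP S A E d) (π : Policy S A E) (s : S) :
    M.horizonValue 0 π s = 0 :=
  expect_pure _ _

theorem expect_cons_utility (M : LMDP S A E d) {p : PMF (List E)} (hp : p.support.Finite) (e : E) :
    expect (p.map fun τ => e :: τ) M.utility = M.reward e + M.mult e *ᵥ expect p M.utility := by
  rw [expect_map hp]
  simp only [utility]
  rw [expect_add hp, expect_const]
  exact congrArg _ (expect_linearMap hp (mulVecLin (M.mult e)) M.utility)

theorem toLex_backup_mono [Finite S] [Finite E] (M : LMDP S A E d) {W W' : S × E → Fin d → ℝ}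
    (h : ∀ x, toLex (W x) ≤ toLex (W' x)) (s : S) (a : A) :
    toLex (M.backup W s a) ≤ toLex (M.backup W' s a) := by
  refine toLex_expect_mono (Set.toFinite _) fun x => ?_
  rw [← sub_nonneg, ← toLex_sub, add_sub_add_left_eq_sub, ← mulVec_sub]
  exact toLex_mulVec_nonneg (M.mult_mem x.2) (sub_nonneg.2 (h x))

variable [Finite S] [Finite A] [Finite E] (M : LMDP S A E d)

section Bellman

theorem finite_support_eventLaw (N : ℕ) (π : Policy S A E) (s : S) :
    (M.eventLaw N π s).support.Finite := by
  induction N generalizing π s with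
  | zero => simp [eventLaw]
  | succ N ih =>
    exact finite_support_bind (Set.toFinite _) fun a => finite_support_bind (Set.toFinite _)
      fun x => finite_support_map (ih _ _) _

theorem finite_support_eventLawAct (N : ℕ) (π : Policy S A E) (s : S) (a : A) :
    (M.eventLawAct N π s a).support.Finite :=
  finite_support_bind (Set.toFinite _) fun _ =>
    finite_support_map (M.finite_support_eventLaw _ _ _) _

theorem expect_eventLawAct (N : ℕ) (π : Policy S A E) (s : S) (a : A) :
    expect (M.eventLawAct N π s a) M.utility =
      M.backup (fun x => M.horizonValue N (π.after s a x.2) x.1) s a := by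
  have hfin (x : S × E) := M.finite_support_eventLaw N (π.after s a x.2) x.1
  rw [eventLawAct, expect_bind (Set.toFinite _) fun x => finite_support_map (hfin x) _]
  simp only [expect_cons_utility, hfin, backup, horizonValue]

theorem horizonValue_succ (N : ℕ) (π : Policy S A E) (s : S) :
    M.horizonValue (N + 1) π s =
      expect (π [] s) fun a => M.backup (fun x => M.horizonValue N (π.after s a x.2) x.1) s a := by
  simp only [← expect_eventLawAct]
  exact expect_bind (Set.toFinite _) (M.finite_support_eventLawAct N π s) _

theorem expect_stepLaw (q : PMF A) (s : S) (f : A × S × E → Fin d → ℝ) :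
    expect (M.stepLaw q s) f = expect q fun a => expect (M.trans s a) fun x => f (a, x) := by
  rw [stepLaw, expect_bind (Set.toFinite _) fun a => Set.toFinite _]
  simp only [expect_map (Set.toFinite _)]

theorem expect_backup_sub_expect_backup (q : PMF A) (s : S) (F G : A → S × E → Fin d → ℝ) :
    (expect q fun a => M.backup (F a) s a) - (expect q fun a => M.backup (G a) s a) =
      expect (M.stepLaw q s) fun z => M.mult z.2.2 *ᵥ (F z.1 z.2 - G z.1 z.2) := by
  simp only [expect_stepLaw, backup, ← expect_sub (Set.toFinite _), add_sub_add_left_eq_sub,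
    mulVec_sub]

end Bellman

section Convergence

theorem norm_mul_horizonValue_succ_sub_le {w : Fin d → ℝ} {β K : ℝ} (hβ : 0 ≤ β)
    (hmult : ∀ e x, ‖w * (M.mult e *ᵥ x)‖ ≤ β * ‖w * x‖) (hreward : ∀ e, ‖w * M.reward e‖ ≤ K)
    (N : ℕ) (π : Policy S A E) (s : S) :
    ‖w * (M.horizonValue (N + 1) π s - M.horizonValue N π s)‖ ≤ K * β ^ N := by
  induction N generalizing π s with
  | zero =>
    rw [horizonValue_succ, horizonValue_zero, sub_zero, pow_zero, mul_one]
    refine norm_mul_expect_le (Set.toFinite _) w fun a => ?_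
    refine norm_mul_expect_le (Set.toFinite _) w fun x => ?_
    simpa only [horizonValue_zero, mulVec_zero, add_zero] using hreward x.2
  | succ N ih =>
    rw [horizonValue_succ, M.horizonValue_succ N, expect_backup_sub_expect_backup]
    refine norm_mul_expect_le (Set.toFinite _) w fun z => (hmult _ _).trans ?_
    calc β * _ ≤ β * (K * β ^ N) := mul_le_mul_of_nonneg_left (ih _ _) hβ
      _ = K * β ^ (N + 1) := by ring

theorem exists_dist_horizonValue_succ_le (hdisc : ∀ e i, M.mult e i i < 1) :
    ∃ β < 1, ∃ K, ∀ (π : Policy S A E) s N,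
      dist (M.horizonValue N π s) (M.horizonValue (N + 1) π s) ≤ K * β ^ N := by
  obtain ⟨w, hw, β, ⟨hβ0, hβ1⟩, hmult⟩ := exists_weight_norm_mulVec_le
    (fun e => isLowerTriangular_of_mem (M.mult_mem e))
    fun e i => (abs_of_nonneg (diag_nonneg_of_mem (M.mult_mem e) i)).trans_lt (hdisc e i)
  obtain ⟨K, hK⟩ := (Set.finite_range fun e => ‖w * M.reward e‖).bddAbove
  refine ⟨β, hβ1, ‖w⁻¹‖ * K, fun π s N => ?_⟩
  set v := M.horizonValue (N + 1) π s - M.horizonValue N π s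
  have hwv : w⁻¹ * (w * v) = v := funext fun k => inv_mul_cancel_left₀ (hw k).ne' _
  calc dist (M.horizonValue N π s) (M.horizonValue (N + 1) π s) = ‖w⁻¹ * (w * v)‖ := by
        rw [dist_comm, dist_eq_norm, hwv]
    _ ≤ ‖w⁻¹‖ * ‖w * v‖ := norm_mul_le _ _
    _ ≤ ‖w⁻¹‖ * (K * β ^ N) := mul_le_mul_of_nonneg_left
        (M.norm_mul_horizonValue_succ_sub_le hβ0.le hmult (fun e => hK ⟨e, rfl⟩) N π s)
        (norm_nonneg _)
    _ = ‖w⁻¹‖ * K * β ^ N := (mul_assoc _ _ _).symm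

variable {M} (hdisc : ∀ e i, M.mult e i i < 1)
include hdisc

theorem tendsto_horizonValue (π : Policy S A E) (s : S) :
    Tendsto (fun N => M.horizonValue N π s) atTop (𝓝 (M.V π s)) := by
  obtain ⟨β, hβ, K, hdist⟩ := M.exists_dist_horizonValue_succ_le hdisc
  exact tendsto_nhds_limUnder
    (cauchySeq_tendsto_of_complete (cauchySeq_of_le_geometric β K hβ (hdist π s)))

theorem exists_norm_V_le : ∃ B, ∀ (π : Policy S A E) s, ‖M.V π s‖ ≤ B := by
  obtain ⟨β, hβ, K, hdist⟩ := M.exists_dist_horizonValue_succ_le hdisc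
  refine ⟨K / (1 - β), fun π s => ?_⟩
  simpa only [horizonValue_zero, dist_zero_left] using
    dist_le_of_le_geometric_of_tendsto₀ β K hβ (hdist π s) (tendsto_horizonValue hdisc π s)

theorem tendsto_expect_eventLawAct_backup (π : Policy S A E) (s : S) (a : A) :
    Tendsto (fun N => expect (M.eventLawAct N π s a) M.utility) atTop
      (𝓝 (M.backup (fun x => M.V (π.after s a x.2) x.1) s a)) := by
  simp only [expect_eventLawAct]
  exact tendsto_expect (Set.toFinite _) fun x => tendsto_const_nhds.add <|
    ((continuous_const.matrix_mulVec continuous_id).tendsto _).comp (tendsto_horizonValue hdisc _ _)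

theorem Q_eq_backup (π : Policy S A E) (s : S) (a : A) :
    M.Q π s a = M.backup (fun x => M.V (π.after s a x.2) x.1) s a :=
  (tendsto_expect_eventLawAct_backup hdisc π s a).limUnder_eq

theorem tendsto_expect_eventLawAct (π : Policy S A E) (s : S) (a : A) :
    Tendsto (fun N => expect (M.eventLawAct N π s a) M.utility) atTop (𝓝 (M.Q π s a)) :=
  Q_eq_backup hdisc π s a ▸ tendsto_expect_eventLawAct_backup hdisc π s a

theorem V_eq_expect_Q (π : Policy S A E) (s : S) : M.V π s = expect (π [] s) (M.Q π s) := by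
  refine tendsto_nhds_unique ((tendsto_add_atTop_iff_nat 1).2 (tendsto_horizonValue hdisc π s)) ?_
  simp only [horizonValue_succ, ← expect_eventLawAct]
  exact tendsto_expect (Set.toFinite _) (tendsto_expect_eventLawAct hdisc π s)

end Convergence

section Comparison

variable {M} (hdisc : ∀ e i, M.mult e i i < 1)
include hdisc

theorem toLex_nonneg_of_expect_stepLaw_le {P : Set (Policy S A E)}
    (hP : ∀ π ∈ P, ∀ s a e, π.after s a e ∈ P) {D : Policy S A E → S → Fin d → ℝ} {B : ℝ}
    (hB : ∀ π s, ‖D π s‖ ≤ B)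
    (h : ∀ π ∈ P, ∀ s, toLex (expect (M.stepLaw (π [] s) s) fun z =>
      M.mult z.2.2 *ᵥ D (π.after s z.1 z.2.2) z.2.1) ≤ toLex (D π s))
    {π : Policy S A E} (hπ : π ∈ P) (s : S) : 0 ≤ toLex (D π s) :=
  toLex_nonneg_of_expect_mulVec_le (X := P × S) (p := fun y => M.stepLaw (y.1.1 [] y.2) y.2)
    (next := fun y z => (⟨y.1.1.after y.2 z.1 z.2.2, hP _ y.1.2 _ _ _⟩, z.2.1))
    (D := fun y => D y.1.1 y.2) (fun z => M.mult_mem z.2.2) (fun z => hdisc z.2.2)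
    (fun y k => (abs_le.1 ((norm_le_pi_norm (D y.1.1 y.2) k).trans (hB _ _))).1)
    (fun y => h _ y.1.2 y.2) (⟨π, hπ⟩, s)

theorem exists_norm_V_sub_le (W : S → Fin d → ℝ) :
    ∃ B, ∀ (π : Policy S A E) s, ‖M.V π s - W s‖ ≤ B := by
  obtain ⟨B, hB⟩ := exists_norm_V_le hdisc
  obtain ⟨K, hK⟩ := (Set.finite_range fun s => ‖W s‖).bddAbove
  exact ⟨B + K, fun π s => norm_sub_le_of_le (hB π s) (hK ⟨s, rfl⟩)⟩

theorem toLex_V_le_of_expect_backup_le {W : S → Fin d → ℝ} {π : Policy S A E}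
    (h : ∀ τ s, toLex (expect (π τ s) (M.backup (fun x => W x.1) s)) ≤ toLex (W s)) (s : S) :
    toLex (M.V π s) ≤ toLex (W s) := by
  obtain ⟨B, hB⟩ := exists_norm_V_sub_le hdisc W
  refine sub_nonneg.1 (toLex_nonneg_of_expect_stepLaw_le hdisc
    (P := {π | ∀ τ s, toLex (expect (π τ s) (M.backup (fun x => W x.1) s)) ≤ toLex (W s)})
    (D := fun π s => W s - M.V π s) (fun _ hπ _ _ _ _ => hπ _)
    (fun π s => (norm_sub_rev _ _).trans_le (hB π s)) (fun π hπ s => ?_) h s)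
  rw [← M.expect_backup_sub_expect_backup (π [] s) s (fun _ x => W x.1)
    fun a x => M.V (π.after s a x.2) x.1]
  simp only [← Q_eq_backup hdisc]
  rw [← V_eq_expect_Q hdisc]
  exact sub_le_sub_right (hπ [] s) _

theorem toLex_le_V_of_le_expect_backup {W : S → Fin d → ℝ} {π : Policy S A E}
    (h : ∀ τ s, toLex (W s) ≤ toLex (expect (π τ s) (M.backup (fun x => W x.1) s))) (s : S) :
    toLex (W s) ≤ toLex (M.V π s) := by
  obtain ⟨B, hB⟩ := exists_norm_V_sub_le hdisc W
  refine sub_nonneg.1 (toLex_nonneg_of_expect_stepLaw_le hdisc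
    (P := {π | ∀ τ s, toLex (W s) ≤ toLex (expect (π τ s) (M.backup (fun x => W x.1) s))})
    (D := fun π s => M.V π s - W s) (fun _ hπ _ _ _ _ => hπ _) hB (fun π hπ s => ?_) h s)
  rw [← M.expect_backup_sub_expect_backup (π [] s) s (fun a x => M.V (π.after s a x.2) x.1)
    fun _ x => W x.1]
  simp only [← Q_eq_backup hdisc]
  rw [← V_eq_expect_Q hdisc]
  exact sub_le_sub_left (hπ [] s) _

end Comparison

section Optimality

variable {M} (hdisc : ∀ e i, M.mult e i i < 1)
include hdisc

theorem Q_stationary (ρ : S → PMF A) (s : S) :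
    M.Q (stationary E ρ) s = M.backup (fun x => M.V (stationary E ρ) x.1) s :=
  funext (Q_eq_backup hdisc (stationary E ρ) s)

theorem Q_stationary_congr {π ρ : S → PMF A}
    (h : M.V (stationary E π) = M.V (stationary E ρ)) :
    M.Q (stationary E π) = M.Q (stationary E ρ) := by
  funext s
  rw [Q_stationary hdisc, Q_stationary hdisc, h]

theorem toLex_V_le_of_le_expect_Q {π ρ : S → PMF A}
    (h : ∀ s, toLex (M.V (stationary E ρ) s) ≤ toLex (expect (π s) (M.Q (stationary E ρ) s)))
    (s : S) : toLex (M.V (stationary E ρ) s) ≤ toLex (M.V (stationary E π) s) := by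
  refine toLex_le_V_of_le_expect_backup hdisc (fun _ s => ?_) s
  rw [← Q_stationary hdisc]
  exact h s

theorem exists_isGreedy_Q_self [Nonempty (S → A)] : ∃ f : S → A,
    IsGreedy (M.Q (stationary E fun s => PMF.pure (f s))) fun s => PMF.pure (f s) := by
  let P (f : S → A) : Policy S A E := stationary E fun s => PMF.pure (f s)
  obtain ⟨f, -, hf⟩ := Set.finite_univ.exists_maximalFor
    (fun (f : S → A) s => toLex (M.V (P f) s)) _ Set.univ_nonempty
  have hmax (s) : ∃ a, ∀ b, toLex (M.Q (P f) s b) ≤ toLex (M.Q (P f) s a) :=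
    have : Nonempty A := ⟨f s⟩
    Finite.exists_max _
  choose g hg using hmax
  have himprove (s) : toLex (M.V (P f) s) ≤ toLex (M.V (P g) s) := by
    refine toLex_V_le_of_le_expect_Q hdisc (fun s => ?_) s
    rw [V_eq_expect_Q hdisc, expect_pure]
    exact (congrArg toLex (expect_pure _ _)).trans_le (hg s (f s))
  have hV : M.V (P g) = M.V (P f) := funext fun s =>
    toLex_inj.1 (le_antisymm (hf (Set.mem_univ g) himprove s) (himprove s))
  refine ⟨g, fun s => ?_⟩
  rw [Q_stationary_congr hdisc hV, expect_pure]
  exact ⟨⟨g s, rfl⟩, Set.forall_mem_range.2 (hg s)⟩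

variable {ρ : S → PMF A} (hρ : IsGreedy (M.Q (stationary E ρ)) ρ)
include hρ

theorem isGreatest_V_of_isGreedy_Q_self (s : S) :
    IsGreatest (Set.range fun a => toLex (M.Q (stationary E ρ) s a))
      (toLex (M.V (stationary E ρ) s)) := by
  rw [V_eq_expect_Q hdisc]
  exact hρ s

theorem toLex_V_le_of_isGreedy_Q_self (π : Policy S A E) (s : S) :
    toLex (M.V π s) ≤ toLex (M.V (stationary E ρ) s) := by
  refine toLex_V_le_of_expect_backup_le hdisc (fun _ s => ?_) s
  rw [← Q_stationary hdisc]
  exact toLex_expect_le (Set.toFinite _)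
    fun a => (isGreatest_V_of_isGreedy_Q_self hdisc hρ s).2 ⟨a, rfl⟩

theorem toLex_Q_le_of_isGreedy_Q_self (π : Policy S A E) (s : S) (a : A) :
    toLex (M.Q π s a) ≤ toLex (M.Q (stationary E ρ) s a) := by
  rw [Q_eq_backup hdisc, Q_stationary hdisc]
  exact M.toLex_backup_mono (fun x => toLex_V_le_of_isGreedy_Q_self hdisc hρ _ x.1) s a

theorem V_stationary_eq_iff_isGreedy {π : S → PMF A} :
    M.V (stationary E π) = M.V (stationary E ρ) ↔ IsGreedy (M.Q (stationary E ρ)) π := by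
  have hgreatest := isGreatest_V_of_isGreedy_Q_self hdisc hρ
  refine ⟨fun hV s => ?_, fun hπ => funext fun s => toLex_inj.1 (le_antisymm ?_ ?_)⟩
  · have hmean : expect (π s) (M.Q (stationary E ρ) s) = M.V (stationary E ρ) s := by
      rw [← hV, ← Q_stationary_congr hdisc hV]
      exact (V_eq_expect_Q hdisc (stationary E π) s).symm
    rw [hmean]
    exact hgreatest s
  · exact toLex_V_le_of_isGreedy_Q_self hdisc hρ _ s
  · exact toLex_V_le_of_le_expect_Q hdisc (fun s => ((hgreatest s).unique (hπ s)).le) s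

theorem isOptimalQ_Q_of_isGreedy_Q_self {C : Set (Policy S A E)} (hC : stationary E ρ ∈ C) :
    M.IsOptimalQ C (M.Q (stationary E ρ)) := fun s a =>
  ⟨⟨_, hC, rfl⟩, Set.forall_mem_image.2 fun π _ => toLex_Q_le_of_isGreedy_Q_self hdisc hρ π s a⟩

theorem isUniformlyOptimal_stationary_iff {C : Set (Policy S A E)} (hC : stationary E ρ ∈ C)
    {π : S → PMF A} :
    M.IsUniformlyOptimal C (stationary E π) ↔ IsGreedy (M.Q (stationary E ρ)) π := by
  rw [← V_stationary_eq_iff_isGreedy hdisc hρ]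
  refine ⟨fun h => funext fun s => toLex_inj.1 (le_antisymm ?_ (h s _ hC)), fun hV s π' _ => ?_⟩
  · exact toLex_V_le_of_isGreedy_Q_self hdisc hρ _ s
  · rw [hV]
    exact toLex_V_le_of_isGreedy_Q_self hdisc hρ π' s

end Optimality

end LMDP

theorem mainTheorem5_general {S A E : Type*} [Finite S] [Finite A] [Finite E] {d : ℕ}
    (M : LMDP S A E d) (hdisc : ∀ (e : E) (i : Fin d), M.mult e i i < 1) :
    (∀ (π : Policy S A E) (s : S),
      Tendsto (fun N => expect (M.eventLaw N π s) M.utility) atTop (𝓝 (M.V π s))) ∧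
    (∀ (π : Policy S A E) (s : S) (a : A),
      Tendsto (fun N => expect (M.eventLawAct N π s a) M.utility) atTop (𝓝 (M.Q π s a))) ∧
    ∀ C : Set (Policy S A E), (∀ f : S → A, stationary E (fun s => PMF.pure (f s)) ∈ C) →
      (∃ Qstar : S → A → Fin d → ℝ, M.IsOptimalQ C Qstar) ∧
      ∀ Qstar : S → A → Fin d → ℝ, M.IsOptimalQ C Qstar →
        ∀ π : S → PMF A,
          (M.IsUniformlyOptimal C (stationary E π) ↔ IsGreedy Qstar π) ∧
          (IsGreedy Qstar π → ∀ s a, M.Q (stationary E π) s a = Qstar s a) := by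
  refine ⟨LMDP.tendsto_horizonValue hdisc, LMDP.tendsto_expect_eventLawAct hdisc, fun C hC => ?_⟩
  rcases isEmpty_or_nonempty (S → A) with hSA | hSA
  · obtain ⟨⟨s₀⟩, hA⟩ := isEmpty_fun.1 hSA
    exact ⟨⟨fun _ => isEmptyElim, fun _ => isEmptyElim⟩,
      fun _ _ π => isEmptyElim (π s₀).support_nonempty.some⟩
  · obtain ⟨f, hf⟩ := LMDP.exists_isGreedy_Q_self hdisc
    have hopt := LMDP.isOptimalQ_Q_of_isGreedy_Q_self hdisc hf (hC f)
    refine ⟨⟨_, hopt⟩, fun Qstar hQstar π => ?_⟩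
    obtain rfl : Qstar = M.Q (stationary E fun s => PMF.pure (f s)) :=
      funext₂ fun s a => toLex_inj.1 ((hQstar s a).unique (hopt s a))
    refine ⟨LMDP.isUniformlyOptimal_stationary_iff hdisc hf (hC f), fun hπ s a => ?_⟩
    have hV := (LMDP.V_stationary_eq_iff_isGreedy hdisc hf).2 hπ
    rw [LMDP.Q_stationary_congr hdisc hV]

theorem mainTheorem5 {S A E : Type*} [Finite S] [Finite A] [Finite E] {d : ℕ}
    (M : LMDP S A E d) (hdisc : ∀ (e : E) (i : Fin d), M.mult e i i < 1) :
    -- the expected returns converge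
    (∀ (π : Policy S A E) (s : S),
      Tendsto (fun N => expect (M.eventLaw N π s) M.utility) atTop (𝓝 (M.V π s))) ∧
    (∀ (π : Policy S A E) (s : S) (a : A),
      Tendsto (fun N => expect (M.eventLawAct N π s a) M.utility) atTop (𝓝 (M.Q π s a))) ∧
    -- optimality within any class of policies that contains the stationary ones
    ∀ C : Set (Policy S A E), (∀ π : S → PMF A, stationary E π ∈ C) →
      (∃ Qstar : S → A → Fin d → ℝ, M.IsOptimalQ C Qstar) ∧
      ∀ Qstar : S → A → Fin d → ℝ, M.IsOptimalQ C Qstar →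
        ∀ π : S → PMF A,
          (M.IsUniformlyOptimal C (stationary E π) ↔ IsGreedy Qstar π) ∧
          (IsGreedy Qstar π → ∀ s a, M.Q (stationary E π) s a = Qstar s a) := by
  obtain ⟨hV, hQ, hopt⟩ := mainTheorem5_general M hdisc
  exact ⟨hV, hQ, fun C hC => hopt C fun f => hC fun s => PMF.pure (f s)⟩
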